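/- Let $n\ge 1$ be an integer, let $S\subseteq\mathbb F_2^n$ be a nonempty set, let $\tau>1$ and $0<\delta\le 1/10$ be real numbers, and let $U_S$ denote a random variable uniformly distributed on $S$. Suppose that $$|S|>\max\left(\frac{n^4(1+\tau)^4}{((\tau-\sqrt\tau)\,\delta)^8},\;n^4\right)$$ and $$n\ \ge\ 20\left\lceil\log_2\left(\max\left(\frac{n(1+\tau)}{((\tau-\sqrt\tau)\,\delta)^2},\;n\right)\right)\right\rceil .$$ Then there exists a natural number $t\le n$ with $$t\ \ge\ \log_2|S|-4\log_2\left(\max\left(n\,\frac{1+\tau}{(\tau-\sqrt\tau)^2\delta^2},\;n\right)\right)$$ such that at least a $(1-\delta)$-fraction of all surjective linear maps $L:\mathbb F_2^n\to\mathbb F_2^t$ have the property that $L(U_S)$ is $\tau 2^{-t}$-close to uniform in the $\ell_\infty$ norm, that is, $$\left|\Pr[L(U_S)=y]-2^{-t}\right|\le\tau 2^{-t}\qquad\text{for every } y\in\mathbb F_2^t .$$ -/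

import Mathlib

/-- The vector space `𝔽₂ⁿ`. -/
abbrev BinSpace (n : ℕ) : Type := Fin n → ZMod 2

/-- Two distributions on a countable set are `ε`-close in the `ℓ_∞` norm: the probabilities of
every single outcome differ by at most `ε`. -/
def LInftyClose {α : Type*} (p r : PMF α) (ε : ℝ) : Prop :=
  ∀ y : α, |(p y).toReal - (r y).toReal| ≤ ε

/-- The distribution of `L(U_S)`, where `U_S` is uniformly distributed on the nonempty finite
set `S ⊆ 𝔽₂ⁿ`. -/
noncomputable def hashDistribution {n t : ℕ} (S : Finset (BinSpace n)) (hS : S.Nonempty)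
    (L : BinSpace n →ₗ[ZMod 2] BinSpace t) : PMF (BinSpace t) :=
  (PMF.uniformOfFinset S hS).map L

/-- The set of all surjective linear maps `𝔽₂ⁿ → 𝔽₂ᵗ`. -/
def surjectiveMaps (n t : ℕ) : Set (BinSpace n →ₗ[ZMod 2] BinSpace t) :=
  {L | Function.Surjective L}

/-- The surjective linear maps `L : 𝔽₂ⁿ → 𝔽₂ᵗ` for which `L(U_S)` is `ε`-close to the uniform
distribution on `𝔽₂ᵗ` in the `ℓ_∞` norm. -/
def goodSurjectiveMaps {n : ℕ} (S : Finset (BinSpace n)) (hS : S.Nonempty) (t : ℕ) (ε : ℝ) :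
    Set (BinSpace n →ₗ[ZMod 2] BinSpace t) :=
  {L | L ∈ surjectiveMaps n t ∧
    LInftyClose (hashDistribution S hS L) (PMF.uniformOfFintype (BinSpace t)) ε}

open Finset

noncomputable section LinearHashing

open scoped Classical

/-! Since `τ > 1`, the lower bound on each probability is automatic, so only fibres with more than
`(1 + τ)|S| / 2 ^ t` points of `S` matter. A fibre is a translate of the kernel. Double counting the
pairs `(L, v)` with `L ∘ v = 0` replaces the kernel by the range of a random map `v = (q, w)` on `V
× W`, where `dim V + dim W = n - t` and `n ≤ |W| = 2 ^ r ≤ 2 * n` (`card_overloaded_surjective_le`).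

The maps `q` and `w` are treated in turn. For random `q`, the number of `c` with `y + q c ∈ S` has
mean `b`, and pairwise independence gives a second moment bound: on average at most a fraction `b /
l ^ 2` of the points `y` are heavy, with count at least `b + l`. Next, let `B` be a sparse set of
heavy points. Passing from `B` to `B ∩ (B - v)` squares the density on average, so `r` random
vectors typically bring it below `1 / |E|`, and then no translate of their span lies in `B`
(`card_cubeTuples_le`).

An overloaded translate, however, produces such a translate of heavy points. The shear `(q, w) ↦ (q
- w ∘ Q, w)` is a bijection that keeps the overload, and for at least half of all `Q` it spreads the
overload so evenly over `W` that every `x + w z` is heavy (`card_overloadedPairs_le`). Hence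
overloaded pairs are at most twice as frequent as heavy ones. -/

instance instFintypeLinearMapZModTwo {V W : Type*} [AddCommGroup V] [Module (ZMod 2) V] [Finite V]
    [AddCommGroup W] [Module (ZMod 2) W] [Finite W] : Fintype (V →ₗ[ZMod 2] W) :=
  @Fintype.ofFinite _ (Finite.of_injective (fun f : V →ₗ[ZMod 2] W => (f : V → W))
    DFunLike.coe_injective)

/-! ### Second moment of the loads of a random shear -/

section Variance

variable {V Y : Type*} [AddCommGroup V] [Module (ZMod 2) V]
  [AddCommGroup Y] [Module (ZMod 2) Y] [Fintype Y]

/-- The number of elements of `T` in the bucket `z` of the hash function `(c, x) ↦ x + q c`. -/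
def shearLoad (T : Finset (V × Y)) (q : V →ₗ[ZMod 2] Y) (z : Y) : ℕ :=
  #{p ∈ T | p.2 + q p.1 = z}

theorem sum_shearLoad (T : Finset (V × Y)) (q : V →ₗ[ZMod 2] Y) :
    ∑ z, (shearLoad T q z : ℝ) = #T := by
  rw [Finset.card_eq_sum_card_fiberwise (s := T) (t := (univ : Finset Y))
    (f := fun p => p.2 + q p.1) (fun _ _ => mem_coe.2 (mem_univ _))]
  simp [shearLoad]

variable [Fintype V]

/-- A random linear map sends a nonzero vector to a uniform one: adding `x ↦ f x • (d - e)`, where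
`f c = 1`, carries the maps with value `e` at `c` to those with value `d`. -/
theorem card_filter_apply_eq {c : V} (hc : c ≠ 0) (d : Y) :
    #{q : V →ₗ[ZMod 2] Y | q c = d} * Fintype.card Y = Fintype.card (V →ₗ[ZMod 2] Y) := by
  obtain ⟨f, hf⟩ : ∃ f : Module.Dual (ZMod 2) V, f c ≠ 0 := by
    by_contra! h
    exact hc ((Module.forall_dual_apply_eq_zero_iff (ZMod 2) c).1 h)
  have hf1 : f c = 1 := by
    generalize f c = a at hf
    revert a
    decide
  have key : ∀ e : Y, #{q : V →ₗ[ZMod 2] Y | q c = e} = #{q : V →ₗ[ZMod 2] Y | q c = d} := by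
    intro e
    refine Finset.card_bij' (fun q _ => q + f.smulRight (d - e))
      (fun q _ => q - f.smulRight (d - e)) ?_ ?_ ?_ ?_
    · intro q hq
      simp only [mem_filter, mem_univ, true_and] at hq ⊢
      simp [hq, hf1]
    · intro q hq
      simp only [mem_filter, mem_univ, true_and] at hq ⊢
      simp [hq, hf1]
    · intro q _
      simp
    · intro q _
      simp
  have h := Finset.card_eq_sum_card_fiberwise (s := (univ : Finset (V →ₗ[ZMod 2] Y)))
    (t := (univ : Finset Y)) (f := fun q => q c) (fun _ _ => mem_coe.2 (mem_univ _))
  rw [Finset.sum_congr rfl (fun e _ => key e)] at h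
  simp only [sum_const, card_univ, smul_eq_mul] at h
  rw [h, mul_comm]

theorem card_filter_collision_mul_le {p p' : V × Y} (h : p ≠ p') :
    #{q : V →ₗ[ZMod 2] Y | p.2 + q p.1 = p'.2 + q p'.1} * Fintype.card Y ≤
      Fintype.card (V →ₗ[ZMod 2] Y) := by
  by_cases h1 : p.1 = p'.1
  · have : #{q : V →ₗ[ZMod 2] Y | p.2 + q p.1 = p'.2 + q p'.1} = 0 := by
      rw [Finset.card_eq_zero, Finset.filter_eq_empty_iff]
      intro q _ hq
      rw [h1] at hq
      exact h (Prod.ext h1 (add_right_cancel hq))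
    rw [this]
    simp
  · rw [← card_filter_apply_eq (sub_ne_zero.2 h1) (p'.2 - p.2)]
    refine Nat.mul_le_mul_right _ (Finset.card_le_card ?_)
    intro q hq
    simp only [mem_filter, mem_univ, true_and, map_sub] at hq ⊢
    rw [sub_eq_sub_iff_add_eq_add, add_comm, hq, add_comm]

theorem sum_sum_shearLoad_sq_le (T : Finset (V × Y)) :
    ∑ q : V →ₗ[ZMod 2] Y, ∑ z, (shearLoad T q z : ℝ) ^ 2 ≤
      Fintype.card (V →ₗ[ZMod 2] Y) * (#T + (#T : ℝ) ^ 2 / Fintype.card Y) := by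
  have hY : (0 : ℝ) < Fintype.card Y := by exact_mod_cast Fintype.card_pos
  have e1 : ∀ q : V →ₗ[ZMod 2] Y, ∑ z, (shearLoad T q z : ℝ) ^ 2 =
      ∑ p ∈ T, ∑ p' ∈ T, if p.2 + q p.1 = p'.2 + q p'.1 then (1 : ℝ) else 0 := by
    intro q
    have : ∀ z, (shearLoad T q z : ℝ) ^ 2 = ∑ p ∈ T, ∑ p' ∈ T,
        (if p.2 + q p.1 = z then (1 : ℝ) else 0) * (if p'.2 + q p'.1 = z then (1 : ℝ) else 0) := by
      intro z
      rw [← Finset.sum_mul_sum, sq]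
      simp [shearLoad]
    simp_rw [this]
    rw [Finset.sum_comm]
    refine Finset.sum_congr rfl fun p _ => ?_
    rw [Finset.sum_comm]
    refine Finset.sum_congr rfl fun p' _ => ?_
    rw [Finset.sum_eq_single (p.2 + q p.1)]
    · simp [eq_comm]
    · intro b _ hb
      rw [if_neg (Ne.symm hb), zero_mul]
    · simp
  simp_rw [e1]
  rw [Finset.sum_comm]
  have e2 : ∀ p ∈ T, ∑ q : V →ₗ[ZMod 2] Y, ∑ p' ∈ T,
      (if p.2 + q p.1 = p'.2 + q p'.1 then (1 : ℝ) else 0) ≤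
      Fintype.card (V →ₗ[ZMod 2] Y) * (1 + (#T : ℝ) / Fintype.card Y) := by
    intro p hp
    rw [Finset.sum_comm]
    have e3 : ∀ p' ∈ T, ∑ q : V →ₗ[ZMod 2] Y,
        (if p.2 + q p.1 = p'.2 + q p'.1 then (1 : ℝ) else 0) ≤
        (if p = p' then (Fintype.card (V →ₗ[ZMod 2] Y) : ℝ) else 0) +
          Fintype.card (V →ₗ[ZMod 2] Y) / Fintype.card Y := by
      intro p' _
      by_cases h : p = p'
      · subst h
        simp only [if_true, sum_const, card_univ, nsmul_eq_mul, mul_one]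
        have : (0 : ℝ) ≤ Fintype.card (V →ₗ[ZMod 2] Y) / Fintype.card Y := by positivity
        linarith
      · rw [if_neg h, zero_add, le_div_iff₀ hY]
        have := card_filter_collision_mul_le h
        rw [Finset.sum_boole]
        exact_mod_cast this
    refine (Finset.sum_le_sum e3).trans (le_of_eq ?_)
    rw [Finset.sum_add_distrib, Finset.sum_ite_eq, if_pos hp]
    simp only [sum_const, nsmul_eq_mul]
    ring
  refine (Finset.sum_le_sum e2).trans (le_of_eq ?_)
  simp only [sum_const, nsmul_eq_mul]
  ring

/-- Distinct points collide with probability at most `1 / |Y|`, so only the diagonal pairs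
contribute to the variance. The bound covers all buckets together, which later replaces a union
bound over them. -/
theorem sum_sum_shearLoad_sub_sq_le (T : Finset (V × Y)) :
    ∑ q : V →ₗ[ZMod 2] Y, ∑ z, ((shearLoad T q z : ℝ) - #T / Fintype.card Y) ^ 2 ≤
      Fintype.card (V →ₗ[ZMod 2] Y) * #T := by
  have hY : (0 : ℝ) < Fintype.card Y := by exact_mod_cast Fintype.card_pos
  have e : ∀ q : V →ₗ[ZMod 2] Y, ∑ z, ((shearLoad T q z : ℝ) - #T / Fintype.card Y) ^ 2 =
      ∑ z, (shearLoad T q z : ℝ) ^ 2 - (#T : ℝ) ^ 2 / Fintype.card Y := by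
    intro q
    simp_rw [sub_sq]
    rw [Finset.sum_add_distrib, Finset.sum_sub_distrib]
    rw [← Finset.sum_mul, ← Finset.mul_sum, sum_shearLoad]
    simp only [sum_const, card_univ, nsmul_eq_mul]
    field_simp
    ring
  simp_rw [e]
  rw [Finset.sum_sub_distrib]
  have := sum_sum_shearLoad_sq_le T
  simp only [sum_const, card_univ, nsmul_eq_mul]
  linarith

end Variance

/-! ### Translates of random spans inside a sparse set -/

section Cube

variable {E : Type*} [AddCommGroup E] [Fintype E]

theorem sum_card_filter_add_mem (B : Finset E) :
    ∑ v, #{y ∈ B | y + v ∈ B} = #B * #B := by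
  have : ∀ v, #{y ∈ B | y + v ∈ B} = ∑ y ∈ B, if y + v ∈ B then 1 else 0 := by
    intro v
    rw [Finset.card_filter]
  simp_rw [this]
  rw [Finset.sum_comm]
  have h2 : ∀ y ∈ B, (∑ v, if y + v ∈ B then 1 else 0) = #B := by
    intro y _
    refine (Fintype.sum_equiv (Equiv.addLeft y) _ (fun v => if v ∈ B then 1 else 0)
      (fun _ => rfl)).trans ?_
    simp
  rw [Finset.sum_congr rfl h2]
  simp

variable [Module (ZMod 2) E]

/-- The tuples `w` such that a translate of the span of `w` lies in `B`. -/
def cubeTuples (B : Finset E) (r : ℕ) : Finset (Fin r → E) :=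
  {w | ∃ x, ∀ z : Fin r → ZMod 2, x + ∑ i, z i • w i ∈ B}

theorem card_cubeTuples_le_pow (B : Finset E) (r : ℕ) :
    (#(cubeTuples B r) : ℝ) ≤ (Fintype.card E : ℝ) ^ r := by
  have h := Finset.card_le_univ (cubeTuples B r)
  rw [Fintype.card_fun, Fintype.card_fin] at h
  exact_mod_cast h

/-- Splitting off the first vector `v`: a translate of the span lies in `B` exactly when the
corresponding translate of the span of the remaining vectors lies in both `B` and `B - v`. -/
theorem card_cubeTuples_succ_le (B : Finset E) (r : ℕ) :
    #(cubeTuples B (r + 1)) ≤ ∑ v, #(cubeTuples ({y ∈ B | y + v ∈ B} : Finset E) r) := by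
  rw [← Finset.card_sigma]
  refine Finset.card_le_card_of_injOn (fun w => ⟨w 0, Fin.tail w⟩) ?_ ?_
  · intro w hw
    simp only [cubeTuples, coe_filter, mem_univ, true_and, Set.mem_ofPred_eq] at hw
    obtain ⟨x, hx⟩ := hw
    simp only [cubeTuples, coe_sigma, Set.mem_sigma_iff, coe_filter, mem_univ, true_and,
      Set.mem_ofPred_eq, mem_filter, coe_univ, Set.mem_univ]
    refine ⟨x, fun z => ⟨?_, ?_⟩⟩
    · have := hx (Fin.cons 0 z)
      rw [Fin.sum_univ_succ] at this
      simpa [Fin.tail] using this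
    · have := hx (Fin.cons 1 z)
      rw [Fin.sum_univ_succ] at this
      simp only [Fin.cons_zero, one_smul, Fin.cons_succ] at this
      rwa [add_comm (w 0), ← add_assoc] at this
  · intro w _ w' _ h
    simp only [Sigma.mk.injEq, heq_eq_eq] at h
    rw [← Fin.cons_self_tail w, ← Fin.cons_self_tail w', h.1, h.2]

/-- A sparse set rarely contains a translate of the span of random vectors. -/
theorem card_cubeTuples_le (r : ℕ) (B : Finset E) (p : ℝ) (hp : 0 < p) (hp1 : p ≤ 1)
    (h : (2 * (#B / Fintype.card E) / p) ^ 2 ^ r ≤ 1 / (Fintype.card E : ℝ)) :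
    (#(cubeTuples B r) : ℝ) ≤ 2 * p * (Fintype.card E : ℝ) ^ r := by
  have hN : (0 : ℝ) < Fintype.card E := by exact_mod_cast Fintype.card_pos
  induction r generalizing B p with
  | zero =>
    -- The hypothesis says `2 * #B ≤ p ≤ 1`.
    have hB : B = ∅ := by
      rw [pow_zero, pow_one, div_le_div_iff₀ hp hN] at h
      have h2 : (#B : ℝ) < 1 := by
        have : 2 * (#B / (Fintype.card E : ℝ)) * Fintype.card E = 2 * #B := by field_simp
        linarith
      rw [← Finset.card_eq_zero]
      have : #B < 1 := by exact_mod_cast h2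
      omega
    have : cubeTuples B 0 = ∅ := by
      simp [cubeTuples, hB]
    rw [this]
    simp only [card_empty, Nat.cast_zero]
    positivity
  | succ r ih =>
    set N : ℝ := (Fintype.card E : ℝ) with hNdef
    set μ : ℝ := #B / N with hμ
    let D : E → Finset E := fun v => {y ∈ B | y + v ∈ B}
    -- The density of `D v` averages to `μ ^ 2`, so by Markov a fraction at most `p` of the `v` is
    -- exceptional.
    let X : Finset E := {v | μ ^ 2 / p * N < #(D v)}
    have hμ0 : 0 ≤ μ := by positivity
    have hnn : 0 ≤ μ ^ 2 / p * N := by positivity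
    have hX : (#X : ℝ) ≤ p * N := by
      rcases hμ0.eq_or_lt with h0 | h0
      · have : X = ∅ := by
          rw [Finset.filter_eq_empty_iff]
          intro v _ hv
          have hB : (#B : ℝ) = 0 := by
            have := h0.symm
            rw [hμ, div_eq_zero_iff] at this
            exact this.resolve_right hN.ne'
          have hle : (#(D v) : ℝ) ≤ #B := Nat.cast_le.2 (Finset.card_filter_le _ _)
          linarith
        rw [this, card_empty, Nat.cast_zero]
        exact mul_nonneg hp.le hN.le
      · have h1 : (#X : ℝ) * (μ ^ 2 / p * N) ≤ ∑ v ∈ X, (#(D v) : ℝ) := by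
          rw [← nsmul_eq_mul]
          refine Finset.card_nsmul_le_sum _ _ _ fun v hv => ?_
          exact (Finset.mem_filter.1 hv).2.le
        have h2 : ∑ v ∈ X, (#(D v) : ℝ) ≤ ∑ v, (#(D v) : ℝ) :=
          Finset.sum_le_sum_of_subset_of_nonneg (Finset.subset_univ _) fun _ _ _ => by positivity
        have h3 : ∑ v, (#(D v) : ℝ) = (μ * N) * (μ * N) := by
          have hB : μ * N = #B := div_mul_cancel₀ _ hN.ne'
          rw [hB]
          exact_mod_cast sum_card_filter_add_mem B
        have h4 : (#X : ℝ) * (μ ^ 2 / p * N) ≤ (p * N) * (μ ^ 2 / p * N) := by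
          refine (h1.trans (h2.trans h3.le)).trans (le_of_eq ?_)
          field_simp
        exact le_of_mul_le_mul_right h4 (by positivity)
    have hstep : ∀ v, v ∉ X → (#(cubeTuples (D v) r) : ℝ) ≤ p * N ^ r := by
      intro v hv
      have hv' : (#(D v) : ℝ) ≤ μ ^ 2 / p * N := by
        by_contra! hc
        exact hv (Finset.mem_filter.2 ⟨mem_univ _, hc⟩)
      -- Halving `p` turns `2 * μ / p` into at most its square, which matches the exponent `2 ^ r`,
      -- and the losses add up to `p + 2 * (p / 2) = 2 * p`.
      have := ih (D v) (p / 2) (by positivity) (by linarith) (by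
        refine le_trans ?_ h
        rw [pow_succ' 2 r, pow_mul]
        refine pow_le_pow_left₀ (by positivity) ?_ _
        have h5 : (#(D v) : ℝ) / N ≤ μ ^ 2 / p := by
          rwa [div_le_iff₀ hN]
        calc 2 * ((#(D v) : ℝ) / N) / (p / 2) ≤ 2 * (μ ^ 2 / p) / (p / 2) := by gcongr
          _ = (2 * μ / p) ^ 2 := by field_simp)
      linarith
    have hsum : (#(cubeTuples B (r + 1)) : ℝ) ≤ ∑ v, (#(cubeTuples (D v) r) : ℝ) := by
      exact_mod_cast card_cubeTuples_succ_le B r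
    refine hsum.trans ?_
    have hb : ∀ v ∈ (univ : Finset E), (#(cubeTuples (D v) r) : ℝ) ≤
        (if v ∈ X then N ^ r else 0) + p * N ^ r := by
      intro v _
      by_cases hv : v ∈ X
      · rw [if_pos hv]
        have := card_cubeTuples_le_pow (D v) r
        have : 0 ≤ p * N ^ r := by positivity
        linarith
      · rw [if_neg hv, zero_add]
        exact hstep v hv
    refine (Finset.sum_le_sum hb).trans ?_
    rw [Finset.sum_add_distrib, ← Finset.sum_filter]
    simp only [sum_const, card_univ, nsmul_eq_mul, Finset.filter_mem_eq_inter, Finset.univ_inter]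
    have : (#X : ℝ) * N ^ r ≤ p * N * N ^ r := by gcongr
    rw [pow_succ]
    linarith

end Cube

/-! ### Heavy points, and spreading an overload by shears -/

section Furstenberg

variable {V W E : Type*} [AddCommGroup V] [Module (ZMod 2) V] [Fintype V]
  [AddCommGroup W] [Module (ZMod 2) W] [Fintype W]
  [AddCommGroup E] [Module (ZMod 2) E]

/-- For most shears, every bucket of a large set has at least `β` elements. -/
theorem card_linearMap_le_two_mul (T : Finset (V × W)) (β : ℝ)
    (hβ : β < #T / Fintype.card W)
    (hT : 2 * (#T : ℝ) ≤ (#T / Fintype.card W - β) ^ 2) :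
    (Fintype.card (V →ₗ[ZMod 2] W) : ℝ) ≤
      2 * #{Q : V →ₗ[ZMod 2] W | ∀ z, β ≤ shearLoad T Q z} := by
  set M : ℝ := #T / Fintype.card W with hM
  let Z : Finset (V →ₗ[ZMod 2] W) := {Q | ¬ ∀ z, β ≤ shearLoad T Q z}
  have hpos : 0 < (M - β) ^ 2 := pow_pos (sub_pos.2 hβ) 2
  have h1 : (#Z : ℝ) * (M - β) ^ 2 ≤ Fintype.card (V →ₗ[ZMod 2] W) * #T := by
    refine le_trans ?_ (sum_sum_shearLoad_sub_sq_le T)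
    rw [← nsmul_eq_mul]
    -- One bucket below `β` already contributes `(M - β) ^ 2 ≥ 2 * #T` to a sum whose average over
    -- `Q` is at most `#T`.
    refine (Finset.card_nsmul_le_sum Z
      (fun Q => ∑ z, ((shearLoad T Q z : ℝ) - M) ^ 2) _ ?_).trans ?_
    · intro Q hQ
      have hQ' := (Finset.mem_filter.1 hQ).2
      push Not at hQ'
      obtain ⟨z, hz⟩ := hQ'
      refine le_trans ?_ (Finset.single_le_sum (f := fun z => ((shearLoad T Q z : ℝ) - M) ^ 2)
        (fun _ _ => sq_nonneg _) (mem_univ z))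
      rw [sub_sq_comm (shearLoad T Q z : ℝ) M]
      exact pow_le_pow_left₀ (sub_pos.2 hβ).le (by linarith) 2
    · exact Finset.sum_le_sum_of_subset_of_nonneg (Finset.subset_univ _)
        fun _ _ _ => Finset.sum_nonneg fun _ _ => sq_nonneg _
  have h2 : (#Z : ℝ) ≤ Fintype.card (V →ₗ[ZMod 2] W) / 2 := by
    refine le_of_mul_le_mul_right (h1.trans ?_) hpos
    have : (Fintype.card (V →ₗ[ZMod 2] W) : ℝ) * (2 * #T) ≤
        Fintype.card (V →ₗ[ZMod 2] W) * (M - β) ^ 2 := by gcongr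
    linarith
  have h3 := Finset.card_filter_add_card_filter_not
    (s := (univ : Finset (V →ₗ[ZMod 2] W))) (fun Q => ∀ z, β ≤ shearLoad T Q z)
  have h4 : (#{Q : V →ₗ[ZMod 2] W | ∀ z, β ≤ shearLoad T Q z} : ℝ) + #Z =
      Fintype.card (V →ₗ[ZMod 2] W) := by
    exact_mod_cast h3
  linarith

/-- The number of `c` with `y + q c ∈ S`. -/
def shiftCount (S : Finset E) (q : V →ₗ[ZMod 2] E) (y : E) : ℕ :=
  #{c | y + q c ∈ S}

/-- This makes the variance bound for shears, applied to `V × S`, available for the counts of `q`.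
-/
theorem shiftCount_eq_shearLoad (S : Finset E) (q : V →ₗ[ZMod 2] E) (y : E) :
    shiftCount S q y = shearLoad (univ ×ˢ S) (-q) y := by
  refine Finset.card_bij' (fun c _ => (c, y + q c)) (fun p _ => p.1) ?_ ?_ ?_ ?_
  · intro c hc
    simpa using hc
  · rintro ⟨c, x⟩ h
    simp only [mem_filter, mem_product, mem_univ, true_and, LinearMap.neg_apply] at h ⊢
    rw [← h.2, add_assoc, neg_add_cancel, add_zero]
    exact h.1
  · intro c _
    rfl
  · rintro ⟨c, x⟩ h
    simp only [mem_filter, mem_product, mem_univ, true_and, LinearMap.neg_apply] at h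
    rw [← h.2, add_assoc, neg_add_cancel, add_zero]

/-- If `y + Q c = z`, then `x + q c + w y = (x + w z) + (q - w ∘ Q) c`. Buckets of an overloaded
translate thus become counts for the sheared pair. -/
theorem shearLoad_eq_shiftCount (S : Finset E) (q : V →ₗ[ZMod 2] E) (w : W →ₗ[ZMod 2] E)
    (Q : V →ₗ[ZMod 2] W) (x : E) (z : W) :
    shearLoad ({c : V × W | x + (q c.1 + w c.2) ∈ S} : Finset (V × W)) Q z =
      shiftCount S (q - w ∘ₗ Q) (x + w z) := by
  symm
  refine Finset.card_bij' (fun c _ => (c, z - Q c)) (fun p _ => p.1) ?_ ?_ ?_ ?_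
  · intro c hc
    simp only [mem_filter, mem_univ, true_and, LinearMap.sub_apply, LinearMap.comp_apply,
      map_sub, sub_add_cancel, and_true] at hc ⊢
    convert hc using 1
    abel
  · rintro ⟨c, y⟩ h
    simp only [mem_filter, mem_univ, true_and, LinearMap.sub_apply, LinearMap.comp_apply] at h ⊢
    rw [← h.2, map_add]
    convert h.1 using 1
    abel
  · intro c _
    rfl
  · rintro ⟨c, y⟩ h
    simp only [mem_filter, mem_univ, true_and] at h
    rw [← h.2, add_sub_cancel_right]

variable [Fintype E]

/-- The points at which `q` has at least `β` preimages in a shift of `S`. -/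
def heavyPoints (S : Finset E) (β : ℝ) (q : V →ₗ[ZMod 2] E) : Finset E :=
  {y | β ≤ shiftCount S q y}

theorem sum_card_heavyPoints_mul_le (S : Finset E) (b l : ℝ) (hl : 0 < l)
    (hb : b = Fintype.card V * #S / Fintype.card E) :
    (∑ q : V →ₗ[ZMod 2] E, (#(heavyPoints S (b + l) q) : ℝ)) * l ^ 2 ≤
      Fintype.card (V →ₗ[ZMod 2] E) * (b * Fintype.card E) := by
  have hE : (0 : ℝ) < Fintype.card E := by exact_mod_cast Fintype.card_pos
  have hT : ((#(univ ×ˢ S : Finset (V × E)) : ℕ) : ℝ) = b * Fintype.card E := by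
    rw [hb, Finset.card_product, card_univ]
    push_cast
    field_simp
  have h1 := sum_sum_shearLoad_sub_sq_le (univ ×ˢ S : Finset (V × E))
  rw [hT, mul_div_cancel_right₀ _ hE.ne', ← Equiv.sum_comp (Equiv.neg _)] at h1
  refine le_trans ?_ h1
  rw [Finset.sum_mul]
  refine Finset.sum_le_sum fun q _ => ?_
  rw [← nsmul_eq_mul]
  refine (Finset.card_nsmul_le_sum (heavyPoints S (b + l) q)
    (fun z => ((shearLoad (univ ×ˢ S) (-q) z : ℝ) - b) ^ 2) _ ?_).trans ?_
  · intro z hz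
    have hz' := (Finset.mem_filter.1 hz).2
    rw [← shiftCount_eq_shearLoad]
    exact pow_le_pow_left₀ hl.le (by linarith) 2
  · exact Finset.sum_le_sum_of_subset_of_nonneg (Finset.subset_univ _)
      fun _ _ _ => sq_nonneg _

/-- The pairs `(q, w)` such that a translate of the range of `w` consists of heavy points
for `q`. -/
def heavyPairs (V W : Type*) [AddCommGroup V] [Module (ZMod 2) V] [Fintype V]
    [AddCommGroup W] [Module (ZMod 2) W] [Fintype W] (S : Finset E) (β : ℝ) :
    Finset ((V →ₗ[ZMod 2] E) × (W →ₗ[ZMod 2] E)) :=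
  {p | ∃ x, ∀ z, x + p.2 z ∈ heavyPoints S β p.1}

/-- The pairs `(q, w)` such that some translate of the sum of the ranges has more than `A`
points in `S`, counted with multiplicity. -/
def overloadedPairs (V W : Type*) [AddCommGroup V] [Module (ZMod 2) V] [Fintype V]
    [AddCommGroup W] [Module (ZMod 2) W] [Fintype W] (S : Finset E) (A : ℝ) :
    Finset ((V →ₗ[ZMod 2] E) × (W →ₗ[ZMod 2] E)) :=
  {p | ∃ x, A < #{c : V × W | x + (p.1 c.1 + p.2 c.2) ∈ S}}

/-- Double counting of pairs and shears: an overloaded pair becomes heavy under at least half of the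
shears, while each shear is injective on pairs. -/
theorem card_overloadedPairs_le (S : Finset E) (A β : ℝ)
    (h : ∀ s : ℝ, A < s → β < s / Fintype.card W ∧ 2 * s ≤ (s / Fintype.card W - β) ^ 2) :
    (#(overloadedPairs V W S A) : ℝ) ≤ 2 * #(heavyPairs V W S β) := by
  let shear : (V →ₗ[ZMod 2] W) → (V →ₗ[ZMod 2] E) × (W →ₗ[ZMod 2] E) →
      (V →ₗ[ZMod 2] E) × (W →ₗ[ZMod 2] E) := fun Q p => (p.1 - p.2 ∘ₗ Q, p.2)
  have hinj : ∀ Q, Function.Injective (shear Q) := by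
    rintro Q ⟨a, b⟩ ⟨a', b'⟩ hab
    simp only [shear, Prod.mk.injEq] at hab
    obtain ⟨h1, rfl⟩ := hab
    rw [sub_left_inj] at h1
    rw [h1]
  have h1 : ∀ p ∈ overloadedPairs V W S A, (Fintype.card (V →ₗ[ZMod 2] W) : ℝ) ≤
      2 * ∑ Q : V →ₗ[ZMod 2] W, if shear Q p ∈ heavyPairs V W S β then (1 : ℝ) else 0 := by
    intro p hp
    obtain ⟨x, hx⟩ := (Finset.mem_filter.1 hp).2
    obtain ⟨ha, hb⟩ := h _ hx
    refine (card_linearMap_le_two_mul _ β ha hb).trans ?_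
    rw [Finset.sum_boole]
    refine mul_le_mul_of_nonneg_left ?_ (by norm_num)
    refine Nat.cast_le.2 (Finset.card_le_card fun Q hQ => ?_)
    refine Finset.mem_filter.2 ⟨mem_univ _, Finset.mem_filter.2 ⟨mem_univ _, x, fun z => ?_⟩⟩
    refine Finset.mem_filter.2 ⟨mem_univ _, ?_⟩
    have := (Finset.mem_filter.1 hQ).2 z
    rwa [shearLoad_eq_shiftCount] at this
  have h2 := Finset.sum_le_sum h1
  rw [← Finset.mul_sum, Finset.sum_comm, sum_const, nsmul_eq_mul] at h2
  have h3 : ∀ Q ∈ (univ : Finset (V →ₗ[ZMod 2] W)),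
      (∑ p ∈ overloadedPairs V W S A,
        if shear Q p ∈ heavyPairs V W S β then (1 : ℝ) else 0) ≤ #(heavyPairs V W S β) := by
    intro Q _
    rw [Finset.sum_boole]
    refine Nat.cast_le.2 (Finset.card_le_card_of_injOn (shear Q) ?_ ((hinj Q).injOn))
    intro p hp
    exact (Finset.mem_filter.1 hp).2
  have h4 := Finset.sum_le_sum h3
  rw [sum_const, nsmul_eq_mul, card_univ] at h4
  have h5 : (0 : ℝ) < Fintype.card (V →ₗ[ZMod 2] W) := by exact_mod_cast Fintype.card_pos
  refine le_of_mul_le_mul_right (h2.trans ?_) h5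
  linarith

theorem card_filter_range_subset_le (B : Finset E) (r : ℕ) :
    #{w : (Fin r → ZMod 2) →ₗ[ZMod 2] E | ∃ x, ∀ z, x + w z ∈ B} ≤ #(cubeTuples B r) := by
  let e := (Pi.basisFun (ZMod 2) (Fin r)).constr (M' := E) (ZMod 2)
  refine Finset.card_le_card_of_injOn e.symm ?_ e.symm.injective.injOn
  intro w hw
  obtain ⟨x, hx⟩ := (Finset.mem_filter.1 hw).2
  refine Finset.mem_filter.2 ⟨mem_univ _, x, fun z => ?_⟩
  have h1 : w z = ∑ i, z i • e.symm w i := by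
    conv_lhs => rw [← e.apply_symm_apply w]
    rw [Module.Basis.constr_apply_fintype]
    simp
  rw [← h1]
  exact hx z

theorem card_linearMap_pi (r : ℕ) :
    Fintype.card ((Fin r → ZMod 2) →ₗ[ZMod 2] E) = Fintype.card E ^ r := by
  rw [← Fintype.card_congr ((Pi.basisFun (ZMod 2) (Fin r)).constr (M' := E) (ZMod 2)).toEquiv,
    Fintype.card_fun, Fintype.card_fin]

/-- The first term is the cube bound for those `q` with few heavy points; the second bounds the
proportion of all other `q`. -/
theorem card_heavyPairs_le (S : Finset E) (r : ℕ) (b l p : ℝ) (hl : 0 < l)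
    (hb : b = Fintype.card V * #S / Fintype.card E) (hp : 0 < p) (hp1 : p ≤ 1)
    (hr : Fintype.card E ≤ 2 ^ 2 ^ r) :
    (#(heavyPairs V (Fin r → ZMod 2) S (b + l)) : ℝ) ≤
      (2 * p + 4 * b / (p * l ^ 2)) * (Fintype.card (V →ₗ[ZMod 2] E) *
        Fintype.card ((Fin r → ZMod 2) →ₗ[ZMod 2] E)) := by
  have hN : (0 : ℝ) < Fintype.card E := by exact_mod_cast Fintype.card_pos
  rw [card_linearMap_pi]
  push_cast
  set N : ℝ := (Fintype.card E : ℝ) with hNdef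
  set H : ℝ := (Fintype.card (V →ₗ[ZMod 2] E) : ℝ) with hH
  -- With density at most `p / 4`, the base in the cube bound is at most `1 / 2`, and `2 ^ 2 ^ r ≥
  -- |E|` suffices. By Markov, the mean density `b / l ^ 2` leaves a fraction `4 * b / (p * l ^ 2)`
  -- of exceptions.
  let X : Finset (V →ₗ[ZMod 2] E) := {q | p / 4 * N < #(heavyPoints S (b + l) q)}
  have hX : (#X : ℝ) ≤ 4 * b / (p * l ^ 2) * H := by
    have h1 : (#X : ℝ) * (p / 4 * N) ≤
        ∑ q : V →ₗ[ZMod 2] E, (#(heavyPoints S (b + l) q) : ℝ) := by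
      rw [← nsmul_eq_mul]
      refine (Finset.card_nsmul_le_sum X
        (fun q => (#(heavyPoints S (b + l) q) : ℝ)) _ fun q hq => ?_).trans ?_
      · exact (Finset.mem_filter.1 hq).2.le
      · exact Finset.sum_le_sum_of_subset_of_nonneg (Finset.subset_univ _)
          fun _ _ _ => by positivity
    have h2 := sum_card_heavyPoints_mul_le (V := V) S b l hl hb
    have h3 : (#X : ℝ) * (p / 4 * N) * l ^ 2 ≤ H * (b * N) :=
      (mul_le_mul_of_nonneg_right h1 (sq_nonneg l)).trans h2
    rw [div_mul_eq_mul_div, le_div_iff₀ (by positivity)]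
    refine le_of_mul_le_mul_right ?_ hN
    linarith
  have hfib : (#(heavyPairs V (Fin r → ZMod 2) S (b + l)) : ℝ) ≤
      ∑ q : V →ₗ[ZMod 2] E, (#(cubeTuples (heavyPoints S (b + l) q) r) : ℝ) := by
    have h1 : #(heavyPairs V (Fin r → ZMod 2) S (b + l)) ≤
        ∑ q : V →ₗ[ZMod 2] E, #{w : (Fin r → ZMod 2) →ₗ[ZMod 2] E |
          ∃ x, ∀ z, x + w z ∈ heavyPoints S (b + l) q} := by
      rw [← Finset.card_sigma]
      refine Finset.card_le_card_of_injOn (fun p => ⟨p.1, p.2⟩) ?_ ?_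
      · intro p hp
        have := (Finset.mem_filter.1 hp).2
        simpa using this
      · rintro ⟨a, c⟩ _ ⟨a', c'⟩ _ h
        simpa using h
    refine (Nat.cast_le.2 h1).trans ?_
    rw [Nat.cast_sum]
    exact Finset.sum_le_sum fun q _ => Nat.cast_le.2 (card_filter_range_subset_le _ r)
  have hb' : ∀ q ∈ (univ : Finset (V →ₗ[ZMod 2] E)),
      (#(cubeTuples (heavyPoints S (b + l) q) r) : ℝ) ≤
        (if q ∈ X then N ^ r else 0) + 2 * p * N ^ r := by
    intro q _
    by_cases hq : q ∈ X
    · rw [if_pos hq]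
      have := card_cubeTuples_le_pow (heavyPoints S (b + l) q) r
      have : 0 ≤ 2 * p * N ^ r := by positivity
      linarith
    · rw [if_neg hq, zero_add]
      have hq' : (#(heavyPoints S (b + l) q) : ℝ) ≤ p / 4 * N := by
        by_contra! hc
        exact hq (Finset.mem_filter.2 ⟨mem_univ _, hc⟩)
      refine card_cubeTuples_le r _ p hp hp1 ?_
      have h5 : (#(heavyPoints S (b + l) q) : ℝ) / N ≤ p / 4 := by rwa [div_le_iff₀ hN]
      calc (2 * ((#(heavyPoints S (b + l) q) : ℝ) / N) / p) ^ 2 ^ r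
          ≤ (2 * (p / 4) / p) ^ 2 ^ r := by gcongr
        _ = 1 / 2 ^ 2 ^ r := by
          rw [show 2 * (p / 4) / p = 1 / 2 by field_simp; norm_num, one_div_pow]
        _ ≤ 1 / N := one_div_le_one_div_of_le hN (by rw [hNdef]; exact_mod_cast hr)
  refine (hfib.trans (Finset.sum_le_sum hb')).trans ?_
  rw [Finset.sum_add_distrib, ← Finset.sum_filter]
  simp only [sum_const, card_univ, nsmul_eq_mul, Finset.filter_mem_eq_inter, Finset.univ_inter]
  have : (#X : ℝ) * N ^ r ≤ 4 * b / (p * l ^ 2) * H * N ^ r := by gcongr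
  linarith

end Furstenberg

/-! ### Injective maps, surjective maps and overloads -/

/-- The injective linear maps. -/
def injectiveLinearMaps (K E : Type*) [AddCommGroup K] [Module (ZMod 2) K] [Finite K]
    [AddCommGroup E] [Module (ZMod 2) E] [Finite E] : Finset (K →ₗ[ZMod 2] E) :=
  {v | Function.Injective v}

/-- The surjective linear maps. -/
def surjectiveLinearMaps (E Y : Type*) [AddCommGroup E] [Module (ZMod 2) E] [Finite E]
    [AddCommGroup Y] [Module (ZMod 2) Y] [Finite Y] : Finset (E →ₗ[ZMod 2] Y) :=
  {L | Function.Surjective L}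

/-- The linear maps `v` such that some translate of `v` has more than `A` points in `S`. -/
def overloadedTranslates (K : Type*) {E : Type*} [AddCommGroup K] [Module (ZMod 2) K] [Fintype K]
    [AddCommGroup E] [Module (ZMod 2) E] [Finite E] (S : Finset E) (A : ℝ) :
    Finset (K →ₗ[ZMod 2] E) :=
  {v | ∃ x, A < #{c | x + v c ∈ S}}

/-- The surjective linear maps with a fibre of more than `A` points of `S`. -/
def overloadedMaps {E : Type*} (Y : Type*) [AddCommGroup E] [Module (ZMod 2) E] [Finite E]
    [AddCommGroup Y] [Module (ZMod 2) Y] [Finite Y] (S : Finset E) (A : ℝ) :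
    Finset (E →ₗ[ZMod 2] Y) :=
  {L | Function.Surjective L ∧ ∃ y, A < #{s ∈ S | L s = y}}

section Membership

variable {K E Y : Type*} [AddCommGroup K] [Module (ZMod 2) K] [Fintype K]
  [AddCommGroup E] [Module (ZMod 2) E] [Finite E] [AddCommGroup Y] [Module (ZMod 2) Y] [Finite Y]

theorem mem_injectiveLinearMaps {v : K →ₗ[ZMod 2] E} :
    v ∈ injectiveLinearMaps K E ↔ Function.Injective v := by
  simp [injectiveLinearMaps]

theorem mem_surjectiveLinearMaps {L : E →ₗ[ZMod 2] Y} :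
    L ∈ surjectiveLinearMaps E Y ↔ Function.Surjective L := by
  simp [surjectiveLinearMaps]

theorem mem_overloadedTranslates {S : Finset E} {A : ℝ} {v : K →ₗ[ZMod 2] E} :
    v ∈ overloadedTranslates K S A ↔ ∃ x, A < #{c | x + v c ∈ S} := by
  simp [overloadedTranslates]

theorem mem_overloadedMaps {S : Finset E} {A : ℝ} {L : E →ₗ[ZMod 2] Y} :
    L ∈ overloadedMaps Y S A ↔ Function.Surjective L ∧ ∃ y, A < #{s ∈ S | L s = y} := by
  simp [overloadedMaps]

end Membership

/-! ### From ranges of injective maps to kernels of surjective maps -/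

section Transfer

variable {K E Y : Type*} [AddCommGroup K] [Module (ZMod 2) K]
  [AddCommGroup E] [Module (ZMod 2) E] [Fintype E]
  [AddCommGroup Y] [Module (ZMod 2) Y]

theorem finrank_ker_of_surjective
    (hd : Module.finrank (ZMod 2) K + Module.finrank (ZMod 2) Y = Module.finrank (ZMod 2) E)
    {L : E →ₗ[ZMod 2] Y} (hL : Function.Surjective L) :
    Module.finrank (ZMod 2) (LinearMap.ker L) = Module.finrank (ZMod 2) K := by
  have h1 := L.finrank_range_add_finrank_ker
  rw [LinearMap.range_eq_top.2 hL, finrank_top] at h1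
  omega

theorem range_eq_ker_of_comp_eq_zero
    (hd : Module.finrank (ZMod 2) K + Module.finrank (ZMod 2) Y = Module.finrank (ZMod 2) E)
    {L : E →ₗ[ZMod 2] Y} (hL : Function.Surjective L)
    {v : K →ₗ[ZMod 2] E} (hv : Function.Injective v) (h : L ∘ₗ v = 0) :
    LinearMap.range v = LinearMap.ker L :=
  Submodule.eq_of_le_of_finrank_eq (LinearMap.range_le_ker_iff.2 h)
    ((LinearMap.finrank_range_of_inj hv).trans (finrank_ker_of_surjective hd hL).symm)

variable [Fintype K]

/-- Union bound over the nonzero `c`, each of which is killed with probability `1 / |E|`. -/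
theorem card_linearMap_le_two_mul_injective (h : 2 * Fintype.card K ≤ Fintype.card E) :
    Fintype.card (K →ₗ[ZMod 2] E) ≤ 2 * #(injectiveLinearMaps K E) := by
  have h1 := Finset.card_filter_add_card_filter_not
    (s := (univ : Finset (K →ₗ[ZMod 2] E))) (fun v => v ∈ injectiveLinearMaps K E)
  rw [card_univ, Finset.filter_mem_eq_inter, Finset.univ_inter] at h1
  have h2 : #{v : K →ₗ[ZMod 2] E | v ∉ injectiveLinearMaps K E} ≤
      ∑ c ∈ univ.erase (0 : K), #{v : K →ₗ[ZMod 2] E | v c = 0} := by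
    refine le_trans (Finset.card_le_card ?_) Finset.card_biUnion_le
    intro v hv
    have hv' := (Finset.mem_filter.1 hv).2
    rw [mem_injectiveLinearMaps, injective_iff_map_eq_zero] at hv'
    push Not at hv'
    obtain ⟨c, hc, hc0⟩ := hv'
    exact Finset.mem_biUnion.2 ⟨c, Finset.mem_erase.2 ⟨hc0, mem_univ _⟩,
      Finset.mem_filter.2 ⟨mem_univ _, hc⟩⟩
  have h3 : (∑ c ∈ univ.erase (0 : K), #{v : K →ₗ[ZMod 2] E | v c = 0}) * Fintype.card E ≤
      Fintype.card K * Fintype.card (K →ₗ[ZMod 2] E) := by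
    rw [Finset.sum_mul, Finset.sum_congr rfl
      (fun c hc => card_filter_apply_eq (Finset.ne_of_mem_erase hc) (0 : E))]
    rw [sum_const, smul_eq_mul]
    exact Nat.mul_le_mul_right _ (Finset.card_le_univ _)
  have hE : 0 < Fintype.card E := Fintype.card_pos
  have h4 : 2 * #{v : K →ₗ[ZMod 2] E | v ∉ injectiveLinearMaps K E} ≤
      Fintype.card (K →ₗ[ZMod 2] E) := by
    refine Nat.le_of_mul_le_mul_right ?_ hE
    calc 2 * #{v : K →ₗ[ZMod 2] E | v ∉ injectiveLinearMaps K E} * Fintype.card E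
        ≤ 2 * (∑ c ∈ univ.erase (0 : K), #{v : K →ₗ[ZMod 2] E | v c = 0}) * Fintype.card E := by
          gcongr
      _ ≤ 2 * (Fintype.card K * Fintype.card (K →ₗ[ZMod 2] E)) := by
          rw [mul_assoc]; gcongr
      _ ≤ Fintype.card (K →ₗ[ZMod 2] E) * Fintype.card E := by
          rw [← mul_assoc, mul_comm]; gcongr
  omega

theorem card_injective_comp_eq_zero
    (hd : Module.finrank (ZMod 2) K + Module.finrank (ZMod 2) Y = Module.finrank (ZMod 2) E)
    {L : E →ₗ[ZMod 2] Y} (hL : Function.Surjective L) :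
    #{v ∈ injectiveLinearMaps K E | L ∘ₗ v = 0} =
      #(injectiveLinearMaps K K) := by
  let e : LinearMap.ker L ≃ₗ[ZMod 2] K :=
    LinearEquiv.ofFinrankEq _ _ (finrank_ker_of_surjective hd hL)
  symm
  refine Finset.card_bij
    (fun g _ => (LinearMap.ker L).subtype ∘ₗ e.symm.toLinearMap ∘ₗ g) ?_ ?_ ?_
  · intro g hg
    have hg' := mem_injectiveLinearMaps.1 hg
    refine Finset.mem_filter.2 ⟨mem_injectiveLinearMaps.2 ?_, ?_⟩
    · exact Subtype.val_injective.comp (e.symm.injective.comp hg')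
    · ext x
      simp
  · intro g _ g' _ h
    ext x
    have := LinearMap.congr_fun h x
    exact e.symm.injective (Subtype.val_injective this)
  · intro v hv
    have hv0 := (Finset.mem_filter.1 hv).2
    have hv1 := mem_injectiveLinearMaps.1 (Finset.mem_filter.1 hv).1
    have hmem : ∀ x, v x ∈ LinearMap.ker L := fun x => LinearMap.congr_fun hv0 x
    refine ⟨e.toLinearMap ∘ₗ v.codRestrict _ hmem, mem_injectiveLinearMaps.2 ?_, ?_⟩
    · refine e.injective.comp fun x y hxy => hv1 ?_
      exact congrArg Subtype.val hxy
    · ext x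
      simp

/-- An overloaded fibre of `L` is an overloaded translate of the range of `v`. -/
theorem card_fiber_le_card_translate
    (hd : Module.finrank (ZMod 2) K + Module.finrank (ZMod 2) Y = Module.finrank (ZMod 2) E)
    (S : Finset E) {L : E →ₗ[ZMod 2] Y}
    (hL : Function.Surjective L) {v : K →ₗ[ZMod 2] E} (hv : Function.Injective v)
    (h : L ∘ₗ v = 0) (y : Y) :
    ∃ x, #{s ∈ S | L s = y} ≤ #{c : K | x + v c ∈ S} := by
  obtain ⟨x, hx⟩ := hL y
  refine ⟨x, Finset.card_le_card_of_surjOn (fun c => x + v c) ?_⟩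
  intro s hs
  have hs' := Finset.mem_filter.1 (Finset.mem_coe.1 hs)
  have hk : s - x ∈ LinearMap.range v := by
    rw [range_eq_ker_of_comp_eq_zero hd hL hv h, LinearMap.mem_ker, map_sub, hs'.2, hx, sub_self]
  obtain ⟨c, hc⟩ := hk
  refine ⟨c, ?_, ?_⟩
  · simp only [coe_filter, mem_univ, true_and, Set.mem_ofPred_eq, hc]
    rw [add_sub_cancel]
    exact hs'.1
  · simp only [hc, add_sub_cancel]

variable [Fintype Y]

theorem card_surjective_comp_eq_zero
    (hd : Module.finrank (ZMod 2) K + Module.finrank (ZMod 2) Y = Module.finrank (ZMod 2) E)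
    {v : K →ₗ[ZMod 2] E} (hv : Function.Injective v) :
    #{L ∈ surjectiveLinearMaps E Y | L ∘ₗ v = 0} =
      #(surjectiveLinearMaps Y Y) := by
  have hq : Module.finrank (ZMod 2) (E ⧸ LinearMap.range v) = Module.finrank (ZMod 2) Y := by
    have h1 := (LinearMap.range v).finrank_quotient_add_finrank
    rw [LinearMap.finrank_range_of_inj hv] at h1
    omega
  let e : (E ⧸ LinearMap.range v) ≃ₗ[ZMod 2] Y := LinearEquiv.ofFinrankEq _ _ hq
  have hmk : Function.Surjective (e.toLinearMap ∘ₗ (LinearMap.range v).mkQ) :=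
    e.surjective.comp (Submodule.mkQ_surjective _)
  symm
  refine Finset.card_bij
    (fun g _ => g ∘ₗ (e.toLinearMap ∘ₗ (LinearMap.range v).mkQ)) ?_ ?_ ?_
  · intro g hg
    have hg' := mem_surjectiveLinearMaps.1 hg
    refine Finset.mem_filter.2 ⟨mem_surjectiveLinearMaps.2 (hg'.comp hmk), ?_⟩
    ext x
    have : (LinearMap.range v).mkQ (v x) = 0 := by simp
    simp only [LinearMap.comp_apply, this, map_zero, LinearMap.zero_apply]
  · intro g _ g' _ h
    exact (LinearMap.cancel_right hmk).1 h
  · intro L hL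
    have hL0 := (Finset.mem_filter.1 hL).2
    have hL1 := mem_surjectiveLinearMaps.1 (Finset.mem_filter.1 hL).1
    have hle : LinearMap.range v ≤ LinearMap.ker L := LinearMap.range_le_ker_iff.2 hL0
    have hcomp : ((LinearMap.range v).liftQ L hle ∘ₗ e.symm.toLinearMap) ∘ₗ
        (e.toLinearMap ∘ₗ (LinearMap.range v).mkQ) = L := by
      ext x
      simp
    refine ⟨(LinearMap.range v).liftQ L hle ∘ₗ e.symm.toLinearMap,
      mem_surjectiveLinearMaps.2 ?_, hcomp⟩
    rw [← hcomp] at hL1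
    exact Function.Surjective.of_comp hL1

/-- Overloaded fibres of surjective maps are as rare as overloaded translates of ranges of
injective maps. -/
theorem card_overloaded_surjective_le
    (hd : Module.finrank (ZMod 2) K + Module.finrank (ZMod 2) Y = Module.finrank (ZMod 2) E)
    (S : Finset E) (A η : ℝ)
    (h : (#(overloadedTranslates K S A) : ℝ) ≤
      η * #(injectiveLinearMaps K E)) :
    (#(overloadedMaps Y S A) : ℝ) ≤
      η * #(surjectiveLinearMaps E Y) := by
  set c₁ := #(injectiveLinearMaps K K) with hc₁
  set c₂ := #(surjectiveLinearMaps Y Y) with hc₂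
  set I := injectiveLinearMaps K E with hI
  set U := surjectiveLinearMaps E Y with hU
  set B := overloadedTranslates K S A with hB
  set D := overloadedMaps Y S A with hD
  let rel : (E →ₗ[ZMod 2] Y) → (K →ₗ[ZMod 2] E) → Prop := fun L v => L ∘ₗ v = 0
  have hc₁0 : (0 : ℝ) < c₁ := by
    exact_mod_cast Finset.card_pos.2 ⟨LinearMap.id, mem_injectiveLinearMaps.2 Function.injective_id⟩
  -- The relation `L ∘ v = 0` is biregular between surjective and injective maps, so proportions on
  -- the two sides can be compared.
  have h1 : ∀ L ∈ U, #(I.bipartiteAbove rel L) = c₁ := fun L hL =>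
    card_injective_comp_eq_zero hd (mem_surjectiveLinearMaps.1 hL)
  have h2 : ∀ v ∈ I, #(U.bipartiteBelow rel v) = c₂ := fun v hv =>
    card_surjective_comp_eq_zero hd (mem_injectiveLinearMaps.1 hv)
  have h3 : #U * c₁ = #I * c₂ := by
    have := Finset.sum_card_bipartiteAbove_eq_sum_card_bipartiteBelow rel (s := U) (t := I)
    rwa [Finset.sum_congr rfl h1, Finset.sum_congr rfl h2, sum_const, sum_const, smul_eq_mul,
      smul_eq_mul] at this
  have h4 : #D * c₁ ≤ #B * c₂ := by
    have hDU : D ⊆ U := fun L hL =>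
      mem_surjectiveLinearMaps.2 (mem_overloadedMaps.1 hL).1
    -- Every injective neighbour of an overloaded `L` is itself overloaded, so no edge at `L` is
    -- lost.
    have e1 : ∀ L ∈ D, #((B ∩ I).bipartiteAbove rel L) = c₁ := by
      intro L hL
      rw [← h1 L (hDU hL)]
      congr 1
      obtain ⟨hLs, y, hy⟩ := mem_overloadedMaps.1 hL
      ext v
      simp only [Finset.bipartiteAbove, mem_filter, mem_inter]
      refine ⟨fun hv => ⟨hv.1.2, hv.2⟩, fun hv => ⟨⟨?_, hv.1⟩, hv.2⟩⟩
      obtain ⟨x, hx⟩ := card_fiber_le_card_translate hd S hLs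
        (mem_injectiveLinearMaps.1 hv.1) hv.2 y
      exact mem_overloadedTranslates.2 ⟨x, hy.trans_le (Nat.cast_le.2 hx)⟩
    have e2 : ∀ v ∈ B ∩ I, #(D.bipartiteBelow rel v) ≤ c₂ := by
      intro v hv
      rw [← h2 v (Finset.mem_inter.1 hv).2]
      exact Finset.card_le_card (Finset.filter_subset_filter _ hDU)
    have := Finset.sum_card_bipartiteAbove_eq_sum_card_bipartiteBelow rel (s := D) (t := B ∩ I)
    rw [Finset.sum_congr rfl e1, sum_const, smul_eq_mul] at this
    rw [this]
    refine (Finset.sum_le_sum e2).trans ?_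
    rw [sum_const, smul_eq_mul]
    exact Nat.mul_le_mul_right _ (Finset.card_le_card Finset.inter_subset_left)
  have h3' : (#U : ℝ) * c₁ = #I * c₂ := by exact_mod_cast h3
  have h4' : (#D : ℝ) * c₁ ≤ #B * c₂ := by exact_mod_cast h4
  refine le_of_mul_le_mul_right ?_ hc₁0
  calc (#D : ℝ) * c₁ ≤ #B * c₂ := h4'
    _ ≤ η * #I * c₂ := by gcongr
    _ = η * #U * c₁ := by rw [mul_assoc, mul_assoc, h3']

end Transfer

/-! ### Assembly for binary spaces -/

theorem card_overloadedTranslates_prod_le {V W E : Type*} [AddCommGroup V] [Module (ZMod 2) V]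
    [Fintype V] [AddCommGroup W] [Module (ZMod 2) W] [Fintype W] [AddCommGroup E]
    [Module (ZMod 2) E] [Fintype E] (S : Finset E) (A : ℝ) :
    #(overloadedTranslates (V × W) S A) ≤ #(overloadedPairs V W S A) := by
  let e := LinearMap.coprodEquiv (R := ZMod 2) (M := V) (M₂ := W) (M₃ := E) (ZMod 2)
  refine Finset.card_le_card_of_injOn e.symm ?_ e.symm.injective.injOn
  intro v hv
  obtain ⟨x, hx⟩ := mem_overloadedTranslates.1 hv
  refine Finset.mem_filter.2 ⟨mem_univ _, x, ?_⟩
  have hv' : ∀ c : V × W, (e.symm v).1 c.1 + (e.symm v).2 c.2 = v c := by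
    intro c
    conv_rhs => rw [← e.apply_symm_apply v]
    rfl
  simpa only [hv'] using hx

/-- The fraction of surjective linear maps with a fibre of more than `A` points of `S`. -/
theorem card_surjective_overloaded_le {n t m r : ℕ} (hn : m + r + t = n) (ht : 1 ≤ t)
    (S : Finset (BinSpace n)) (A b l p : ℝ) (hl : 0 < l) (hb : b = #S / (2 : ℝ) ^ (t + r))
    (hp : 0 < p) (hp1 : p ≤ 1) (hr : n ≤ 2 ^ r)
    (h : ∀ s : ℝ, A < s → b + l < s / 2 ^ r ∧ 2 * s ≤ (s / 2 ^ r - (b + l)) ^ 2) :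
    (#(overloadedMaps (BinSpace t) S A) : ℝ) ≤
      (8 * p + 16 * b / (p * l ^ 2)) *
        #(surjectiveLinearMaps (BinSpace n) (BinSpace t)) := by
  have hcard : ∀ k, Fintype.card (BinSpace k) = 2 ^ k := fun k => by
    rw [Fintype.card_fun, ZMod.card, Fintype.card_fin]
  refine card_overloaded_surjective_le (K := BinSpace m × BinSpace r) (by simp; omega) S A _ ?_
  have hb0 : 0 ≤ b := by rw [hb]; positivity
  have hb' : b = Fintype.card (BinSpace m) * #S / Fintype.card (BinSpace n) := by
    have hpow : (2 : ℝ) ^ n = 2 ^ m * 2 ^ (t + r) := by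
      rw [← hn, add_assoc, pow_add 2 m, add_comm r t]
    rw [hb, hcard, hcard]
    push_cast
    rw [hpow]
    field_simp
  have h1 : (Fintype.card (BinSpace m × BinSpace r →ₗ[ZMod 2] BinSpace n) : ℝ) ≤
      2 * #(injectiveLinearMaps (BinSpace m × BinSpace r) (BinSpace n)) := by
    have : 2 * Fintype.card (BinSpace m × BinSpace r) ≤ Fintype.card (BinSpace n) := by
      rw [Fintype.card_prod, hcard, hcard, hcard, ← pow_add, ← pow_succ']
      exact Nat.pow_le_pow_right (by norm_num) (by omega)
    exact_mod_cast card_linearMap_le_two_mul_injective this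
  let e := LinearMap.coprodEquiv (R := ZMod 2) (M := BinSpace m) (M₂ := BinSpace r)
    (M₃ := BinSpace n) (ZMod 2)
  have h2 : Fintype.card (BinSpace m × BinSpace r →ₗ[ZMod 2] BinSpace n) =
      Fintype.card (BinSpace m →ₗ[ZMod 2] BinSpace n) *
        Fintype.card (BinSpace r →ₗ[ZMod 2] BinSpace n) := by
    rw [← Fintype.card_congr e.toEquiv, Fintype.card_prod]
  have h4 := card_overloadedPairs_le (V := BinSpace m) (W := BinSpace r) S A (b + l) (by
    rw [hcard]
    exact_mod_cast h)
  have h5 := card_heavyPairs_le (V := BinSpace m) S r b l p hl hb' hp hp1 (by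
    rw [hcard]
    exact Nat.pow_le_pow_right (by norm_num) hr)
  have h2' : (Fintype.card (BinSpace m →ₗ[ZMod 2] BinSpace n) : ℝ) *
        Fintype.card (BinSpace r →ₗ[ZMod 2] BinSpace n) =
      Fintype.card (BinSpace m × BinSpace r →ₗ[ZMod 2] BinSpace n) := by exact_mod_cast h2.symm
  rw [h2'] at h5
  have h6 : 0 ≤ 2 * p + 4 * b / (p * l ^ 2) := by positivity
  have h7 := mul_le_mul_of_nonneg_left h1 h6
  have h8 : (#(overloadedTranslates (BinSpace m × BinSpace r) S A) : ℝ) ≤ #(overloadedPairs (BinSpace m) (BinSpace r) S A) :=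
    Nat.cast_le.2 (card_overloadedTranslates_prod_le S A)
  have h9 : (8 * p + 16 * b / (p * l ^ 2)) = 4 * (2 * p + 4 * b / (p * l ^ 2)) := by ring
  rw [h9]
  linarith

theorem hashDistribution_apply_toReal {n t : ℕ} (S : Finset (BinSpace n)) (hS : S.Nonempty)
    (L : BinSpace n →ₗ[ZMod 2] BinSpace t) (y : BinSpace t) :
    (hashDistribution S hS L y).toReal = #{s ∈ S | L s = y} / #S := by
  have h1 : hashDistribution S hS L y = #{s ∈ S | L s = y} * (#S : ENNReal)⁻¹ := by
    rw [← nsmul_eq_mul, ← sum_const, Finset.sum_filter, hashDistribution, PMF.map_apply,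
      tsum_fintype]
    simp only [PMF.uniformOfFinset_apply]
    refine (Finset.sum_subset (Finset.subset_univ S) fun s _ hs => ?_).symm.trans
      (Finset.sum_congr rfl fun s hs => ?_)
    · simp [hs]
    · simp [hs, eq_comm]
  rw [h1, ENNReal.toReal_mul, ENNReal.toReal_inv, ENNReal.toReal_natCast, ENNReal.toReal_natCast,
    div_eq_mul_inv]

theorem mem_goodSurjectiveMaps_of_card_fiber_le {n t : ℕ} (S : Finset (BinSpace n))
    (hS : S.Nonempty) {τ : ℝ} (hτ : 1 ≤ τ) {L : BinSpace n →ₗ[ZMod 2] BinSpace t}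
    (hL : Function.Surjective L)
    (h : ∀ y, (#{s ∈ S | L s = y} : ℝ) ≤ (1 + τ) * (#S / 2 ^ t)) :
    L ∈ goodSurjectiveMaps S hS t (τ * (2 : ℝ) ^ (-(t : ℤ))) := by
  refine ⟨hL, fun y => ?_⟩
  have hS0 : (0 : ℝ) < #S := by exact_mod_cast hS.card_pos
  -- Only the upper bound needs `h`; the lower one holds because `2 ^ (-t) ≤ τ * 2 ^ (-t)`.
  rw [hashDistribution_apply_toReal, PMF.uniformOfFintype_apply, ENNReal.toReal_inv,
    ENNReal.toReal_natCast, Fintype.card_fun, ZMod.card, Fintype.card_fin, zpow_neg, zpow_natCast]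
  push_cast
  have h1 : (#{s ∈ S | L s = y} : ℝ) / #S ≤ (1 + τ) * ((2 : ℝ) ^ t)⁻¹ := by
    rw [div_le_iff₀ hS0]
    refine (h y).trans (le_of_eq ?_)
    rw [div_eq_mul_inv]
    ring
  have h2 : 0 ≤ (#{s ∈ S | L s = y} : ℝ) / #S := by positivity
  have h3 : (0 : ℝ) < ((2 : ℝ) ^ t)⁻¹ := by positivity
  rw [abs_le]
  constructor <;> nlinarith

theorem ncard_goodSurjectiveMaps_ge {n t : ℕ} (S : Finset (BinSpace n))
    (hS : S.Nonempty) {τ δ : ℝ} (hτ : 1 ≤ τ)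
    (h : (#(overloadedMaps (BinSpace t) S ((1 + τ) * (#S / 2 ^ t))) : ℝ) ≤
      δ * #(surjectiveLinearMaps (BinSpace n) (BinSpace t))) :
    ((goodSurjectiveMaps S hS t (τ * (2 : ℝ) ^ (-(t : ℤ)))).ncard : ℝ) ≥
        (1 - δ) * ((surjectiveMaps n t).ncard : ℝ) := by
  have h1 : (surjectiveMaps n t).ncard =
      #(surjectiveLinearMaps (BinSpace n) (BinSpace t)) := by
    rw [← Set.ncard_coe_finset]
    congr 1
    ext L
    simp [surjectiveMaps, mem_surjectiveLinearMaps]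
  have h2 : surjectiveMaps n t ⊆ goodSurjectiveMaps S hS t (τ * (2 : ℝ) ^ (-(t : ℤ))) ∪
      overloadedMaps (BinSpace t) S ((1 + τ) * (#S / 2 ^ t)) := by
    intro L hL
    by_cases hf : ∃ y, (1 + τ) * (#S / 2 ^ t) < (#{s ∈ S | L s = y} : ℝ)
    · refine Or.inr (mem_overloadedMaps.2 ⟨hL, ?_⟩)
      convert hf
    · push Not at hf
      exact Or.inl (mem_goodSurjectiveMaps_of_card_fiber_le S hS hτ hL hf)
  have h3 := (Set.ncard_le_ncard h2 (Set.toFinite _)).trans (Set.ncard_union_le _ _)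
  rw [Set.ncard_coe_finset] at h3
  have h3' : ((surjectiveMaps n t).ncard : ℝ) ≤
      (goodSurjectiveMaps S hS t (τ * (2 : ℝ) ^ (-(t : ℤ)))).ncard +
        #(overloadedMaps (BinSpace t) S ((1 + τ) * (#S / 2 ^ t))) := by exact_mod_cast h3
  rw [← h1] at h
  linarith

/-! ### Choice of parameters -/

/-- The numerical estimates behind `exists_card_surjective_overloaded_le`. -/
theorem bucket_estimates {n M τ δ b R : ℝ} (hn : 20 ≤ n) (hτ : 1 < τ) (hδ0 : 0 < δ)
    (hδ : δ ≤ 1) (hM : n ≤ M)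
    (hM' : n * ((1 + τ) / ((τ - Real.sqrt τ) ^ 2 * δ ^ 2)) ≤ M) (hR0 : 0 < R) (hR : R ≤ 2 * n)
    (hb : M ^ 4 / 2 ≤ b * R) :
    8 * (δ / 16) + 16 * b / (δ / 16 * (Real.sqrt τ * b) ^ 2) ≤ δ ∧
      ∀ s, (1 + τ) * (b * R) < s →
        b + Real.sqrt τ * b < s / R ∧ 2 * s ≤ (s / R - (b + Real.sqrt τ * b)) ^ 2 := by
  have hτ0 : 0 < τ := by linarith
  obtain ⟨w, hw⟩ : ∃ w, w = Real.sqrt τ := ⟨_, rfl⟩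
  rw [← hw] at hM' ⊢
  have hw1 : 1 < w := by rw [hw]; exact Real.lt_sqrt_of_sq_lt (by simpa using hτ)
  have hwsq : w ^ 2 = τ := by rw [hw]; exact Real.sq_sqrt hτ0.le
  have hu : 0 < τ - w := by nlinarith
  obtain ⟨u, hu'⟩ : ∃ u, u = τ - w := ⟨_, rfl⟩
  rw [← hu'] at hM' hu
  have hM0 : 0 < M := by linarith
  have hc : n * (1 + τ) ≤ M * (u ^ 2 * δ ^ 2) := by
    rwa [← mul_div_assoc, div_le_iff₀ (by positivity)] at hM'
  have hb0 : 0 < b := by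
    by_contra! h
    have : b * R ≤ 0 := mul_nonpos_of_nonpos_of_nonneg h hR0.le
    have : 0 < M ^ 4 / 2 := by positivity
    linarith
  have hbn : M ^ 4 ≤ 4 * b * n := by
    have := mul_le_mul_of_nonneg_left hR hb0.le
    linarith
  have hbM : M ^ 3 ≤ 4 * b := by
    refine le_of_mul_le_mul_right ?_ hM0
    have : 4 * b * n ≤ 4 * b * M := by gcongr
    linarith [show M ^ 3 * M = M ^ 4 by ring]
  have hδτ : n ≤ M * (τ * δ ^ 2) := by
    refine le_of_mul_le_mul_right ?_ (show 0 < τ by linarith)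
    have h1 : u ^ 2 ≤ τ ^ 2 := by
      apply pow_le_pow_left₀ hu.le
      linarith
    have h2 : M * (u ^ 2 * δ ^ 2) ≤ M * (τ ^ 2 * δ ^ 2) := by gcongr
    linarith [show M * (τ ^ 2 * δ ^ 2) = M * (τ * δ ^ 2) * τ by ring]
  have hM3 : 8000 ≤ M ^ 3 := by
    have : (20 : ℝ) ^ 3 ≤ M ^ 3 := pow_le_pow_left₀ (by norm_num) (by linarith) 3
    linarith
  constructor
  -- With `p = δ / 16` and `l = √τ * b`, the second term is `256 / (δ * τ * b)`, which is at most `δ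
  -- / 2` exactly when `τ * δ ^ 2 * b ≥ 512`.
  · have h1 : 512 ≤ τ * δ ^ 2 * b := by
      refine le_of_mul_le_mul_right ?_ hM0
      have h2 : b * n ≤ b * (M * (τ * δ ^ 2)) := by gcongr
      have h3 : 8000 * M ≤ M ^ 3 * M := by gcongr
      linarith [show M ^ 3 * M = M ^ 4 by ring,
        show b * (M * (τ * δ ^ 2)) = τ * δ ^ 2 * b * M by ring]
    have h4 : 16 * b / (δ / 16 * (w * b) ^ 2) ≤ δ / 2 := by
      rw [div_le_iff₀ (by positivity), mul_pow, hwsq]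
      have := mul_le_mul_of_nonneg_right h1 hb0.le
      linarith [show δ / 2 * (δ / 16 * (τ * b ^ 2)) = τ * δ ^ 2 * b * b / 32 by ring]
    linarith
  · intro s hs
    obtain ⟨x, hx⟩ : ∃ x, x = s / R := ⟨_, rfl⟩
    have hsx : s = x * R := by rw [hx]; field_simp
    rw [← hx, hsx]
    have hxb : (1 + τ) * b < x := by
      rw [hx, lt_div_iff₀ hR0]
      linarith
    have hx0 : 0 < x := lt_trans (by positivity) hxb
    -- As `b < x / (1 + τ)`, the gap `x - (1 + w) * b` is at least the fraction `(τ - w) / (1 + τ)`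
    -- of `x`. This is where `τ - √τ` enters.
    have h1 : x * u ≤ (1 + τ) * (x - (b + w * b)) := by
      have : (1 + w) * ((1 + τ) * b) ≤ (1 + w) * x := by gcongr
      rw [hu']
      linarith
    have h2 : 0 < x - (b + w * b) :=
      pos_of_mul_pos_right (lt_of_lt_of_le (by positivity) h1) (by linarith)
    refine ⟨by linarith, ?_⟩
    have h3 : (x * u) ^ 2 ≤ ((1 + τ) * (x - (b + w * b))) ^ 2 :=
      pow_le_pow_left₀ (by positivity) h1 2
    have h4 : 2 * R * (1 + τ) ≤ b * u ^ 2 := by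
      have e1 : 2 * R * (1 + τ) ≤ 4 * (n * (1 + τ)) := by
        have : R * (1 + τ) ≤ 2 * n * (1 + τ) := by gcongr
        linarith
      have e2 : M * (u ^ 2 * δ ^ 2) ≤ M * (u ^ 2 * 1) := by
        gcongr
        exact pow_le_one₀ hδ0.le hδ
      have e3 : 4 * M ≤ b := by
        have : (20 : ℝ) ^ 2 ≤ M ^ 2 := pow_le_pow_left₀ (by norm_num) (by linarith) 2
        have : 400 * M ≤ M ^ 2 * M := mul_le_mul_of_nonneg_right (by linarith) hM0.le
        linarith [show M ^ 2 * M = M ^ 3 by ring]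
      have e4 : 4 * M * u ^ 2 ≤ b * u ^ 2 := by gcongr
      linarith
    have h5 : 2 * (x * R) * (1 + τ) ^ 2 ≤ (x * u) ^ 2 := by
      have e1 : (1 + τ) * x * (2 * R * (1 + τ)) ≤ (1 + τ) * x * (b * u ^ 2) := by gcongr
      have e2 : (1 + τ) * b * (x * u ^ 2) ≤ x * (x * u ^ 2) := by gcongr
      linarith
    refine le_of_mul_le_mul_right ?_ (show 0 < (1 + τ) ^ 2 by positivity)
    linarith [show ((1 + τ) * (x - (b + w * b))) ^ 2 = (x - (b + w * b)) ^ 2 * (1 + τ) ^ 2 by ring]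

/-- If `S` is larger than `M ^ 4`, most surjective maps onto a space of size about
`|S| / M ^ 4` have no overloaded fibre. -/
theorem exists_card_surjective_overloaded_le {n : ℕ} (hn : 20 ≤ n) (S : Finset (BinSpace n))
    {M τ δ : ℝ} (hτ : 1 < τ) (hδ0 : 0 < δ) (hδ : δ ≤ 1) (hM : n ≤ M)
    (hM' : n * ((1 + τ) / ((τ - Real.sqrt τ) ^ 2 * δ ^ 2)) ≤ M) (hS : M ^ 4 < #S) :
    ∃ t ≤ n, (#S : ℝ) ≤ M ^ 4 * 2 ^ t ∧
      (#(overloadedMaps (BinSpace t) S ((1 + τ) * (#S / 2 ^ t))) : ℝ) ≤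
      δ * #(surjectiveLinearMaps (BinSpace n) (BinSpace t)) := by
  have hn' : (20 : ℝ) ≤ n := by exact_mod_cast hn
  have hM0 : 0 < M := by linarith
  have hM4 : 0 < M ^ 4 := by positivity
  -- The dimension is `t = k + 1`: rounding up gives `#S ≤ M ^ 4 * 2 ^ t`, at the cost of a factor 2
  -- in the mean load `#S / 2 ^ t ≥ M ^ 4 / 2`.
  obtain ⟨k, hk1, hk2⟩ := exists_nat_pow_near (x := (#S : ℝ) / M ^ 4) (y := 2)
    ((one_le_div hM4).2 hS.le) (by norm_num)
  rw [le_div_iff₀ hM4] at hk1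
  rw [div_lt_iff₀ hM4] at hk2
  obtain ⟨r, hr1, hr2⟩ : ∃ r, n ≤ 2 ^ r ∧ 2 ^ r ≤ 2 * n := by
    refine ⟨Nat.clog 2 n, Nat.le_pow_clog (by norm_num) n, ?_⟩
    have h1 := Nat.pow_pred_clog_lt_self (b := 2) (by norm_num) (show 1 < n by omega)
    have h2 : 0 < Nat.clog 2 n := Nat.clog_pos (by norm_num) (by omega)
    have h3 : 2 ^ Nat.clog 2 n = 2 * 2 ^ (Nat.clog 2 n).pred := by
      rw [← pow_succ', Nat.pred_eq_sub_one, Nat.sub_add_cancel h2]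
    omega
  have hr2' : (2 : ℝ) ^ r ≤ 2 * n := by exact_mod_cast hr2
  have hScard : (#S : ℝ) ≤ 2 ^ n := by
    have := Finset.card_le_univ S
    rw [Fintype.card_fun, ZMod.card, Fintype.card_fin] at this
    exact_mod_cast this
  -- There is room for `V`: since `2 ^ r ≤ 2 * M`, the product `2 ^ (k + 1 + r) * M ^ 3` is at most
  -- `4 * #S ≤ 4 * 2 ^ n`.
  have hle : k + 1 + r ≤ n := by
    have h1 : (2 : ℝ) ^ (k + 1 + r) * M ^ 3 ≤ 2 ^ n * M ^ 3 := by
      have e1 : (2 : ℝ) ^ (k + 1 + r) * M ^ 3 = 2 * 2 ^ k * M ^ 3 * 2 ^ r := by ring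
      have e2 : 2 * 2 ^ k * M ^ 3 * 2 ^ r ≤ 2 * 2 ^ k * M ^ 3 * (2 * M) := by
        gcongr
        linarith
      have e3 : (2 : ℝ) ^ n * 4 ≤ 2 ^ n * M ^ 3 := by
        gcongr
        have : (20 : ℝ) ^ 3 ≤ M ^ 3 := pow_le_pow_left₀ (by norm_num) (by linarith) 3
        linarith
      linarith [show 2 * 2 ^ k * M ^ 3 * (2 * M) = 4 * (2 ^ k * M ^ 4) by ring]
    have h2 := le_of_mul_le_mul_right h1 (by positivity)
    exact (pow_le_pow_iff_right₀ (by norm_num)).1 h2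
  refine ⟨k + 1, by omega, by linarith, ?_⟩
  obtain ⟨m, hm⟩ : ∃ m, m + r + (k + 1) = n := ⟨n - (k + 1 + r), by omega⟩
  set b : ℝ := #S / 2 ^ (k + 1 + r) with hb
  have hbR : b * 2 ^ r = #S / 2 ^ (k + 1) := by
    rw [hb, pow_add]
    field_simp
  have hbM : M ^ 4 / 2 ≤ b * 2 ^ r := by
    rw [hbR, le_div_iff₀ (by positivity), pow_succ (2 : ℝ) k]
    linarith
  have hb0 : 0 < b := by
    have : (0 : ℝ) < #S := hM4.trans hS
    positivity
  obtain ⟨h1, h2⟩ := bucket_estimates hn' hτ hδ0 hδ hM hM' (by positivity) hr2' hbM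
  rw [hbR] at h2
  have h3 := card_surjective_overloaded_le hm (by omega) S _ b (Real.sqrt τ * b) (δ / 16)
    (mul_pos (Real.sqrt_pos.2 (by linarith)) hb0) hb (by linarith) (by linarith) hr1 h2
  exact h3.trans (mul_le_mul_of_nonneg_right h1 (Nat.cast_nonneg _))

end LinearHashing

theorem mainTheorem6 (n : ℕ) (hn : 1 ≤ n) (S : Finset (BinSpace n)) (hS : S.Nonempty)
    (τ δ : ℝ) (hτ : 1 < τ) (hδ0 : 0 < δ) (hδ : δ ≤ 1 / 10)
    (hcard : (S.card : ℝ) >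
      max ((n : ℝ) ^ 4 * (1 + τ) ^ 4 / ((τ - Real.sqrt τ) * δ) ^ 8) ((n : ℝ) ^ 4))
    (hlarge : (n : ℤ) ≥
      20 * ⌈Real.logb 2 (max ((n : ℝ) * (1 + τ) / ((τ - Real.sqrt τ) * δ) ^ 2) (n : ℝ))⌉) :
    ∃ t : ℕ, t ≤ n ∧
      (t : ℝ) ≥ Real.logb 2 (S.card : ℝ) -
        4 * Real.logb 2
          (max ((n : ℝ) * ((1 + τ) / ((τ - Real.sqrt τ) ^ 2 * δ ^ 2))) (n : ℝ)) ∧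
      ((goodSurjectiveMaps S hS t (τ * (2 : ℝ) ^ (-(t : ℤ)))).ncard : ℝ) ≥
        (1 - δ) * ((surjectiveMaps n t).ncard : ℝ) := by
  have hn0 : (1 : ℝ) ≤ n := by exact_mod_cast hn
  have hS0 : (0 : ℝ) < S.card := by exact_mod_cast hS.card_pos
  set M : ℝ := max ((n : ℝ) * ((1 + τ) / ((τ - Real.sqrt τ) ^ 2 * δ ^ 2))) (n : ℝ) with hM
  have hnM : (n : ℝ) ≤ M := le_max_right _ _
  have hM0 : 0 < M := by linarith
  have hlog : ∀ t : ℕ, (S.card : ℝ) ≤ M ^ 4 * 2 ^ t →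
      (t : ℝ) ≥ Real.logb 2 (S.card : ℝ) - 4 * Real.logb 2 M := by
    intro t ht
    have h1 := Real.logb_le_logb_of_le (b := 2) (by norm_num) hS0 ht
    rw [Real.logb_mul (by positivity) (by positivity), Real.logb_pow, Real.logb_pow,
      Real.logb_self_eq_one (by norm_num)] at h1
    push_cast at h1
    linarith
  rcases Nat.lt_or_ge 1 n with hn1 | hn1
  -- For `n > 1` the logarithm in `hlarge` is positive, so its ceiling is at least 1.
  · have hn20 : 20 ≤ n := by
      have hlogn : 0 < Real.logb 2
          (max ((n : ℝ) * (1 + τ) / ((τ - Real.sqrt τ) * δ) ^ 2) (n : ℝ)) := by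
        refine Real.logb_pos (by norm_num) (lt_of_lt_of_le ?_ (le_max_right _ _))
        exact_mod_cast hn1
      have := Int.ceil_pos.2 hlogn
      omega
    have hMS : M ^ 4 < S.card := by
      obtain ⟨h1, h2⟩ := max_lt_iff.1 hcard
      rcases max_choice ((n : ℝ) * ((1 + τ) / ((τ - Real.sqrt τ) ^ 2 * δ ^ 2))) (n : ℝ) with h | h
      · rw [hM, h]
        refine lt_of_eq_of_lt ?_ h1
        rw [mul_pow, div_pow, mul_div_assoc]
        congr 2
        ring
      · rw [hM, h]
        exact h2
    obtain ⟨t, ht, hSt, hbad⟩ := exists_card_surjective_overloaded_le hn20 S hτ hδ0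
      (by linarith) hnM (le_max_left _ _) hMS
    exact ⟨t, ht, hlog t hSt, ncard_goodSurjectiveMaps_ge S hS hτ.le hbad⟩
  -- For `n = 1` the ceiling may vanish. Here `#S ≥ 2`, and `t = 1` works because every surjective
  -- map is bijective and its fibres have at most one point.
  · obtain rfl : n = 1 := le_antisymm hn1 hn
    have hS1 : (1 : ℝ) < S.card := by
      simpa using (max_lt_iff.1 hcard).2
    have hS2 : (2 : ℝ) ≤ S.card := by
      have : 1 < S.card := by exact_mod_cast hS1
      exact_mod_cast this
    refine ⟨1, le_rfl, hlog 1 ?_, ?_⟩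
    · have h1 := Finset.card_le_univ S
      rw [Fintype.card_fun, ZMod.card, Fintype.card_fin] at h1
      have h2 : (S.card : ℝ) ≤ 2 ^ 1 := by exact_mod_cast h1
      have h3 : (1 : ℝ) ≤ M ^ 4 := one_le_pow₀ (by simpa using hnM)
      linarith
    · have hsub : surjectiveMaps 1 1 ⊆
          goodSurjectiveMaps S hS 1 (τ * (2 : ℝ) ^ (-((1 : ℕ) : ℤ))) := by
        intro L hL
        refine mem_goodSurjectiveMaps_of_card_fiber_le S hS hτ.le hL fun y => ?_
        have hinj : Function.Injective L := LinearMap.injective_iff_surjective.2 hL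
        have h1 : (S.filter fun s => L s = y).card ≤ 1 :=
          Finset.card_le_one.2 fun a ha b hb => hinj
            ((Finset.mem_filter.1 ha).2.trans (Finset.mem_filter.1 hb).2.symm)
        have h2 : ((S.filter fun s => L s = y).card : ℝ) ≤ 1 := by exact_mod_cast h1
        convert h2.trans ?_
        rw [pow_one]
        nlinarith
      have h1 : ((surjectiveMaps 1 1).ncard : ℝ) ≤
          (goodSurjectiveMaps S hS 1 (τ * (2 : ℝ) ^ (-((1 : ℕ) : ℤ)))).ncard :=
        Nat.cast_le.2 (Set.ncard_le_ncard hsub (Set.toFinite _))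
      have h2 : (0 : ℝ) ≤ δ * (surjectiveMaps 1 1).ncard := by positivity
      linarith
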